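/- **Setting.** Let $(E,\mathcal E,\mu)$ be a probability space and let $\mathcal H$ be a separable reproducing kernel Hilbert space of real functions on $E$ whose reproducing kernel $k:E\times E\to\mathbb R$ is measurable. Put $\kappa(x)=\sqrt{k(x,x)}$ and assume $\|\kappa\|_{2,\mu}<\infty$, where $\|\cdot\|_{p,\mu}$ is the norm of $L^p_\mu$. Let $f:E\to\mathbb R$ be measurable with $\|f\|_{2,\mu}<\infty$. Let $J:\mathcal H\to L^2_\mu$ be the bounded operator that maps $h$ to its $\mu$-equivalence class, let $\lambda\ge 0$ be such that $J^*J+\lambda:\mathcal H\to\mathcal H$ is invertible, and put $$h_\lambda=(J^*J+\lambda)^{-1}J^*f\in\mathcal H,\qquad f_\lambda=Jh_\lambda\in L^2_\mu .$$ For an i.i.d. sequence $\boldsymbol X=(X^{(1)},X^{(2)},\dots)$ with law $\boldsymbol\mu=\mu\otimes\mu\otimes\cdots$ on $E\times E\times\cdots$ and for $n\ge 1$, let $\mu_{\boldsymbol X}=\frac1n\sum_{i=1}^n\delta_{X^{(i)}}$, let $J_{\boldsymbol X}:\mathcal H\to L^2_{\mu_{\boldsymbol X}}$ be the analogue of $J$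 for $\mu_{\boldsymbol X}$, and let $h_{\boldsymbol X}=(J_{\boldsymbol X}^*J_{\boldsymbol X}+\lambda)^{-1}J_{\boldsymbol X}^*f$, with $h_{\boldsymbol X}=0$ if $J_{\boldsymbol X}^*J_{\boldsymbol X}+\lambda$ is not invertible. Fix $\delta\in[0,1)$ and let $$\mathcal S=\big\{\|J_{\boldsymbol X}^*J_{\boldsymbol X}-J^*J\|_2\le \delta/\|(J^*J+\lambda)^{-1}\|\big\},$$ where $\|\cdot\|_2$ is the Hilbert--Schmidt norm and $\|\cdot\|$ the operator norm. **Theorem (concentration inequality).** Assume that $\|\kappa\|_{\infty,\mu}<\infty$ and $\|f\kappa\|_{\infty,\mu}<\infty$. Then $(f-f_\lambda)\kappa\in L^\infty_\mu$, and for all $n\ge1$ and all $\tau>0$ $$\boldsymbol\mu\big[\mathbf 1_{\mathcal S}\|h_{\boldsymbol X}-h_\lambda\|_{\mathcal H}\ge\tau\big]\le 2e^{-\frac{\tau^2n}{2C_1}},\qquad C_1=\Big(\frac{2\|(J^*J+\lambda)^{-1}\|}{1-\delta}\Big)^2\|(f-f_\lambda)\kappa\|_{\infty,\mu}^2 .$$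 If $\lambda>0$, then moreover for all $n\ge1$ and all $\tau>0$ $$\boldsymbol\mu\big[\|h_{\boldsymbol X}-h_\lambda\|_{\mathcal H}\ge\tau\big]\le 2e^{-\frac{\tau^2n}{2C_2}},\qquad C_2=\Big(\frac{2}{\lambda}\Big)^2\|(f-f_\lambda)\kappa\|_{\infty,\mu}^2,$$ and $C_2\ge 4\|Q\|$, where $Q:\mathcal H\to\mathcal H$ is the self-adjoint operator given by $\langle Qh,h\rangle_{\mathcal H}=\mathbb V_\mu\big[(f-f_\lambda)\,J(J^*J+\lambda)^{-1}h\big]$ for $h\in\mathcal H$, with $\mathbb V_\mu[g]=\|g\|_{2,\mu}^2-\big(\int g\,d\mu\big)^2$. If $C_1=0$ or $C_2=0$, the corresponding right-hand side is read as $0$. -/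

import Mathlib

open MeasureTheory
open scoped ENNReal InnerProductSpace

noncomputable section

namespace KernelRidge

variable {E : Type*} {H : Type*} [NormedAddCommGroup H] [InnerProductSpace ℝ H]
  [CompleteSpace H] [RKHS ℝ H E ℝ]

/-- The (scalar) reproducing kernel `k(x, y)` of the real RKHS `H` of functions on `E`. -/
def kernel (H : Type*) [NormedAddCommGroup H] [InnerProductSpace ℝ H] [CompleteSpace H]
    {E : Type*} [RKHS ℝ H E ℝ] (x y : E) : ℝ :=
  RKHS.kernel H x y 1

/-- The function `κ(x) = √k(x, x)`. -/
def kappa (H : Type*) [NormedAddCommGroup H] [InnerProductSpace ℝ H] [CompleteSpace H]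
    {E : Type*} [RKHS ℝ H E ℝ] (x : E) : ℝ :=
  √(kernel H x x)

theorem kernel_eq_apply (x y : E) : kernel H x y = RKHS.kerFun H y 1 x :=
  (RKHS.kerFun_apply H y 1 x).symm

theorem inner_kerFun_one (h : H) (x : E) : ⟪h, RKHS.kerFun H x (1 : ℝ)⟫_ℝ = h x := by
  simp

theorem kappa_eq_norm (x : E) : kappa H x = ‖RKHS.kerFun H x (1 : ℝ)‖ := by
  rw [kappa, kernel_eq_apply, ← inner_kerFun_one, real_inner_self_eq_norm_sq,
    Real.sqrt_sq (norm_nonneg _)]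

theorem kappa_nonneg (x : E) : 0 ≤ kappa H x := Real.sqrt_nonneg _

theorem abs_apply_le (h : H) (x : E) : |h x| ≤ ‖h‖ * kappa H x := by
  rw [← inner_kerFun_one, kappa_eq_norm]
  exact abs_real_inner_le_norm _ _

variable [MeasurableSpace E]

theorem measurable_kappa (hk : Measurable fun p : E × E => kernel H p.1 p.2) :
    Measurable (kappa H : E → ℝ) :=
  (hk.comp (measurable_id.prodMk measurable_id)).sqrt

theorem measurable_coe (hk : Measurable fun p : E × E => kernel H p.1 p.2) (h : H) :
    Measurable (fun x : E => h x) := by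
  have hcl : h ∈ closure
      ((Submodule.span ℝ {g : H | ∃ (x : E) (v : ℝ), RKHS.kerFun H x v = g} : Submodule ℝ H) :
        Set H) := by
    have := RKHS.kerFun_dense (𝕜 := ℝ) (X := E) (V := ℝ) H
    rw [← Submodule.topologicalClosure_coe, this]
    trivial
  obtain ⟨u, hu, hlim⟩ := mem_closure_iff_seq_limit.1 hcl
  refine measurable_of_tendsto_metrizable (f := fun n (x : E) => u n x) (fun n => ?_)
    (tendsto_pi_nhds.2 fun x => ((RKHS.continuous_eval (𝕜 := ℝ) (H := H) x).tendsto h).comp hlim)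
  refine Submodule.span_induction (p := fun g _ => Measurable fun x : E => g x)
    ?_ ?_ ?_ ?_ (hu n)
  · rintro g ⟨y, v, rfl⟩
    have : (fun x : E => RKHS.kerFun H y v x) = fun x : E => v * kernel H x y := by
      funext x
      rw [kernel_eq_apply, ← smul_eq_mul, ← Pi.smul_apply, ← RKHS.coe_smul, ← map_smul]
      simp
    rw [this]
    exact (hk.comp (measurable_id.prodMk measurable_const)).const_mul v
  · simp
  · intro a b _ _ ha hb
    simp only [RKHS.coe_add, Pi.add_apply]
    exact Measurable.fun_add ha hb
  · intro c a _ ha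
    simpa using ha.const_mul c

theorem memLp_coe (hk : Measurable fun p : E × E => kernel H p.1 p.2) {ν : Measure E}
    (hκ : MemLp (kappa H) 2 ν) (h : H) : MemLp (fun x : E => h x) 2 ν :=
  (hκ.const_mul ‖h‖).mono (measurable_coe hk h).aestronglyMeasurable <| .of_forall fun x => by
    rw [Real.norm_eq_abs, Real.norm_eq_abs, abs_of_nonneg
      (mul_nonneg (norm_nonneg h) (kappa_nonneg x))]
    exact abs_apply_le h x

/-- The embedding `J : H → L²(ν)` which maps `h` to its `ν`-equivalence class. -/
def embedding (hk : Measurable fun p : E × E => kernel H p.1 p.2) (ν : Measure E)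
    (hκ : MemLp (kappa H) 2 ν) : H →L[ℝ] Lp ℝ 2 ν :=
  LinearMap.mkContinuous
    { toFun := fun h => (memLp_coe hk hκ h).toLp _
      map_add' := fun a b => by
        rw [← MemLp.toLp_add]
        congr 1
        funext x
        simp
      map_smul' := fun c a => by
        rw [RingHom.id_apply, ← MemLp.toLp_const_smul]
        congr 1
        funext x
        simp }
    ‖hκ.toLp (kappa H)‖
    (fun h => by
      rw [mul_comm, ← Real.norm_of_nonneg (norm_nonneg h)]
      rw [norm_norm, ← norm_norm h, ← norm_smul, ← MemLp.toLp_const_smul]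
      refine Lp.norm_le_norm_of_ae_le ?_
      filter_upwards [(memLp_coe hk hκ h).coeFn_toLp, (hκ.const_smul ‖h‖).coeFn_toLp]
        with x h1 h2
      change ‖((memLp_coe hk hκ h).toLp _ : E → ℝ) x‖ ≤ _
      rw [h1, h2, Pi.smul_apply, smul_eq_mul, Real.norm_eq_abs, Real.norm_eq_abs, abs_of_nonneg
        (mul_nonneg (norm_nonneg h) (kappa_nonneg x))]
      exact abs_apply_le h x)

theorem coeFn_embedding (hk : Measurable fun p : E × E => kernel H p.1 p.2) (ν : Measure E)
    (hκ : MemLp (kappa H) 2 ν) (h : H) : embedding hk ν hκ h =ᵐ[ν] fun x => h x :=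
  (memLp_coe hk hκ h).coeFn_toLp

/-- The operator `J* J : H → H`. -/
def gram (hk : Measurable fun p : E × E => kernel H p.1 p.2) (ν : Measure E)
    (hκ : MemLp (kappa H) 2 ν) : H →L[ℝ] H :=
  (embedding hk ν hκ).adjoint ∘L embedding hk ν hκ

/-- The operator `J* J + λ : H → H`. -/
def regGram (hk : Measurable fun p : E × E => kernel H p.1 p.2) (ν : Measure E)
    (hκ : MemLp (kappa H) 2 ν) (lam : ℝ) : H →L[ℝ] H :=
  gram hk ν hκ + lam • 1

/-- The operator `(J* J + λ)⁻¹ : H → H`; by convention it is `0` if `J* J + λ` is not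
invertible. -/
def regInv (hk : Measurable fun p : E × E => kernel H p.1 p.2) (ν : Measure E)
    (hκ : MemLp (kappa H) 2 ν) (lam : ℝ) : H →L[ℝ] H :=
  Ring.inverse (regGram hk ν hκ lam)

/-- The regularized solution `h_λ = (J* J + λ)⁻¹ J* f` in `H` (equal to `0` if `J* J + λ` is not
invertible). -/
def ridge (hk : Measurable fun p : E × E => kernel H p.1 p.2) (ν : Measure E)
    (hκ : MemLp (kappa H) 2 ν) {f : E → ℝ} (hf : MemLp f 2 ν) (lam : ℝ) : H :=
  regInv hk ν hκ lam ((embedding hk ν hκ).adjoint (hf.toLp f))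

/-- The empirical measure `(1/n) ∑_{i < n} δ_{X i}` of the first `n` points of the sequence `X`. -/
def empirical (n : ℕ) (X : ℕ → E) : Measure E :=
  (n : ℝ≥0∞)⁻¹ • ∑ i ∈ Finset.range n, Measure.dirac (X i)

theorem memLp_empirical {g : E → ℝ} (hg : Measurable g) (n : ℕ) (X : ℕ → E) :
    MemLp g 2 (empirical n X) := by
  rcases Nat.eq_zero_or_pos n with rfl | hn
  · simp [empirical]
  refine MemLp.smul_measure ?_ (by simp [hn.ne'])
  refine ⟨hg.aestronglyMeasurable, ?_⟩
  rw [eLpNorm_lt_top_iff_lintegral_rpow_enorm_lt_top (by simp) (by simp)]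
  rw [lintegral_finsetSum_measure]
  refine ENNReal.sum_lt_top.2 fun i _ => ?_
  rw [lintegral_dirac' _ (by fun_prop)]
  simp

/-- The sample operator `J_X* J_X`, for the empirical measure in place of `μ`. -/
def sampleGram (hk : Measurable fun p : E × E => kernel H p.1 p.2) (n : ℕ) (X : ℕ → E) :
    H →L[ℝ] H :=
  gram hk (empirical n X) (memLp_empirical (measurable_kappa hk) n X)

/-- The sample estimator `h_X = (J_X* J_X + λ)⁻¹ J_X* f`, equal to `0` if `J_X* J_X + λ` is not
invertible. -/
def sampleRidge (hk : Measurable fun p : E × E => kernel H p.1 p.2) {f : E → ℝ}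
    (hfm : Measurable f) (lam : ℝ) (n : ℕ) (X : ℕ → E) : H :=
  ridge hk (empirical n X) (memLp_empirical (measurable_kappa hk) n X)
    (memLp_empirical hfm n X) lam

/-- The Hilbert--Schmidt norm `(∑ᵢ ‖T φᵢ‖²)^{1/2} ∈ [0, ∞]` of an operator on `H`, for an
orthonormal (Hilbert) basis `(φᵢ)` of `H`; the value does not depend on the basis. -/
def hsNorm {H : Type*} [NormedAddCommGroup H] [InnerProductSpace ℝ H] [CompleteSpace H]
    (T : H →L[ℝ] H) : ℝ≥0∞ :=
  (∑' i, ‖T ((exists_hilbertBasis ℝ H).choose_spec.choose i)‖ₑ ^ 2) ^ (1 / 2 : ℝ)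

/-- The sampling event
`S = {‖J_X* J_X - J* J‖₂ ≤ δ / ‖(J* J + λ)⁻¹‖}` in the space of sequences `E × E × ⋯`. -/
def samplingEvent (hk : Measurable fun p : E × E => kernel H p.1 p.2) (μ : Measure E)
    (hκ : MemLp (kappa H) 2 μ) (lam δ : ℝ) (n : ℕ) : Set (ℕ → E) :=
  {X | hsNorm (sampleGram hk n X - gram hk μ hκ) ≤ ENNReal.ofReal (δ / ‖regInv hk μ hκ lam‖)}

/-- The function `(f - f_λ) κ`, where `f_λ = J h_λ`. -/
def residualKappa (hk : Measurable fun p : E × E => kernel H p.1 p.2) (μ : Measure E)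
    (hκ : MemLp (kappa H) 2 μ) {f : E → ℝ} (hf : MemLp f 2 μ) (lam : ℝ) (x : E) : ℝ :=
  (f x - embedding hk μ hκ (ridge hk μ hκ hf lam) x) * kappa H x

theorem memLp_residual_mul (hk : Measurable fun p : E × E => kernel H p.1 p.2) {μ : Measure E}
    (hκ : MemLp (kappa H) 2 μ) {f : E → ℝ} (hf : MemLp f 2 μ) (lam : ℝ)
    (hr : MemLp (residualKappa hk μ hκ hf lam) 2 μ) (h : H) :
    MemLp (fun x => (f x - embedding hk μ hκ (ridge hk μ hκ hf lam) x) *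
      embedding hk μ hκ h x) 2 μ := by
  refine (hr.const_mul ‖h‖).mono
    ((hf.1.sub (Lp.aestronglyMeasurable _)).mul (Lp.aestronglyMeasurable _)) ?_
  filter_upwards [coeFn_embedding hk μ hκ h] with x hx
  rw [hx, residualKappa, norm_mul, norm_mul, norm_mul, norm_norm,
    Real.norm_of_nonneg (kappa_nonneg x), mul_left_comm]
  exact mul_le_mul_of_nonneg_left (abs_apply_le h x) (norm_nonneg _)

/-- The operator `H → L²(μ)`, `h ↦ (f - f_λ) J h`, if `(f - f_λ) κ ∈ L²(μ)`. -/
def residualMul (hk : Measurable fun p : E × E => kernel H p.1 p.2) (μ : Measure E)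
    (hκ : MemLp (kappa H) 2 μ) {f : E → ℝ} (hf : MemLp f 2 μ) (lam : ℝ)
    (hr : MemLp (residualKappa hk μ hκ hf lam) 2 μ) : H →L[ℝ] Lp ℝ 2 μ :=
  LinearMap.mkContinuous
    { toFun := fun h => (memLp_residual_mul hk hκ hf lam hr h).toLp _
      map_add' := fun a b => by
        rw [← MemLp.toLp_add, MemLp.toLp_eq_toLp_iff, map_add]
        filter_upwards [Lp.coeFn_add (embedding hk μ hκ a) (embedding hk μ hκ b)] with x hx
        rw [hx, Pi.add_apply, Pi.add_apply, mul_add]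
      map_smul' := fun c a => by
        rw [RingHom.id_apply, ← MemLp.toLp_const_smul, MemLp.toLp_eq_toLp_iff, map_smul]
        filter_upwards [Lp.coeFn_smul c (embedding hk μ hκ a)] with x hx
        simp [hx, mul_left_comm] }
    ‖hr.toLp _‖
    (fun h => by
      rw [mul_comm, ← norm_norm h, ← norm_smul, ← MemLp.toLp_const_smul]
      refine Lp.norm_le_norm_of_ae_le ?_
      filter_upwards [(memLp_residual_mul hk hκ hf lam hr h).coeFn_toLp,
        (hr.const_smul ‖h‖).coeFn_toLp, coeFn_embedding hk μ hκ h] with x h1 h2 h3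
      change ‖((memLp_residual_mul hk hκ hf lam hr h).toLp _ : E → ℝ) x‖ ≤ _
      rw [h1, h2, h3, Pi.smul_apply, smul_eq_mul, residualKappa, norm_mul, norm_mul, norm_mul,
        norm_norm, Real.norm_of_nonneg (kappa_nonneg x), mul_left_comm]
      exact mul_le_mul_of_nonneg_left (abs_apply_le h x) (norm_nonneg _))

/-- The asymptotic covariance operator `Q`: with `T h = (f - f_λ) J (J* J + λ)⁻¹ h`, it is
`Q = T* T - ⟨·, T* 1⟩ T* 1`. By `isSelfAdjoint_asympCov` and `inner_asympCov` below it is the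
self-adjoint operator with `⟨Q h, h⟩ = Var_μ[(f - f_λ) J (J* J + λ)⁻¹ h]`. -/
def asympCov (hk : Measurable fun p : E × E => kernel H p.1 p.2) (μ : Measure E)
    [IsProbabilityMeasure μ] (hκ : MemLp (kappa H) 2 μ) {f : E → ℝ} (hf : MemLp f 2 μ) (lam : ℝ)
    (hr : MemLp (residualKappa hk μ hκ hf lam) 2 μ) : H →L[ℝ] H :=
  let T : H →L[ℝ] Lp ℝ 2 μ := residualMul hk μ hκ hf lam hr ∘L regInv hk μ hκ lam
  let m : H := T.adjoint ((memLp_const (1 : ℝ)).toLp fun _ => 1)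
  T.adjoint ∘L T - (innerSL ℝ m).smulRight m

theorem isSelfAdjoint_asympCov (hk : Measurable fun p : E × E => kernel H p.1 p.2)
    (μ : Measure E) [IsProbabilityMeasure μ] (hκ : MemLp (kappa H) 2 μ) {f : E → ℝ}
    (hf : MemLp f 2 μ) (lam : ℝ) (hr : MemLp (residualKappa hk μ hκ hf lam) 2 μ) :
    IsSelfAdjoint (asympCov hk μ hκ hf lam hr) := by
  rw [ContinuousLinearMap.isSelfAdjoint_iff_isSymmetric]
  intro a b
  simp only [asympCov, ContinuousLinearMap.coe_coe, sub_apply,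
    ContinuousLinearMap.comp_apply, ContinuousLinearMap.smulRight_apply, innerSL_apply_apply,
    inner_sub_left, inner_sub_right, inner_smul_left, inner_smul_right,
    ContinuousLinearMap.adjoint_inner_left, ContinuousLinearMap.adjoint_inner_right]
  simp [real_inner_comm, mul_comm]

theorem inner_asympCov (hk : Measurable fun p : E × E => kernel H p.1 p.2)
    (μ : Measure E) [IsProbabilityMeasure μ] (hκ : MemLp (kappa H) 2 μ) {f : E → ℝ}
    (hf : MemLp f 2 μ) (lam : ℝ) (hr : MemLp (residualKappa hk μ hκ hf lam) 2 μ) (h : H) :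
    ⟪asympCov hk μ hκ hf lam hr h, h⟫_ℝ =
      ProbabilityTheory.variance (fun x => (f x - embedding hk μ hκ (ridge hk μ hκ hf lam) x) *
        embedding hk μ hκ (regInv hk μ hκ lam h) x) μ := by
  have hm := memLp_residual_mul hk hκ hf lam hr (regInv hk μ hκ lam h)
  have hT : residualMul hk μ hκ hf lam hr (regInv hk μ hκ lam h) = hm.toLp _ := rfl
  rw [ProbabilityTheory.variance_eq_sub hm]
  simp only [asympCov, sub_apply,
    ContinuousLinearMap.comp_apply, ContinuousLinearMap.smulRight_apply, innerSL_apply_apply,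
    inner_sub_left, inner_smul_left, ContinuousLinearMap.adjoint_inner_left, hT]
  congr 1
  · rw [L2.inner_def]
    refine integral_congr_ae ?_
    filter_upwards [hm.coeFn_toLp] with x hx
    rw [hx, real_inner_self_eq_norm_sq, Real.norm_eq_abs, sq_abs, Pi.pow_apply]
  · rw [sq, L2.inner_def]
    have : ∫ x, ⟪((memLp_const (1 : ℝ)).toLp (fun _ => (1 : ℝ)) : Lp ℝ 2 μ) x,
        (hm.toLp _ : Lp ℝ 2 μ) x⟫_ℝ ∂μ = ∫ x,
        (f x - embedding hk μ hκ (ridge hk μ hκ hf lam) x) *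
        embedding hk μ hκ (regInv hk μ hκ lam h) x ∂μ := by
      refine integral_congr_ae ?_
      filter_upwards [hm.coeFn_toLp, (memLp_const (μ := μ) (p := 2) (1 : ℝ)).coeFn_toLp]
        with x hx h1
      rw [hx, h1]
      simp
    rw [this]
    simp

/-- The constant `C₁ = (2 ‖(J* J + λ)⁻¹‖ / (1 - δ))² ‖(f - f_λ) κ‖²_∞`. -/
def constTruncated (hk : Measurable fun p : E × E => kernel H p.1 p.2) (μ : Measure E)
    (hκ : MemLp (kappa H) 2 μ) {f : E → ℝ} (hf : MemLp f 2 μ) (lam δ : ℝ) : ℝ :=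
  (2 * ‖regInv hk μ hκ lam‖ / (1 - δ)) ^ 2 *
    (eLpNorm (residualKappa hk μ hκ hf lam) ∞ μ).toReal ^ 2

/-- The constant `C₂ = (2 / λ)² ‖(f - f_λ) κ‖²_∞`. -/
def constFull (hk : Measurable fun p : E × E => kernel H p.1 p.2) (μ : Measure E)
    (hκ : MemLp (kappa H) 2 μ) {f : E → ℝ} (hf : MemLp f 2 μ) (lam : ℝ) : ℝ :=
  (2 / lam) ^ 2 * (eLpNorm (residualKappa hk μ hκ hf lam) ∞ μ).toReal ^ 2

/-- The bound `2 exp(-τ² n / (2 C))`, read as its limit `0` when `C = 0`. -/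
def tailBound (C : ℝ) (n : ℕ) (τ : ℝ) : ℝ :=
  if C = 0 then 0 else 2 * Real.exp (-(τ ^ 2 * n) / (2 * C))

end KernelRidge

end

/-! The error is controlled through an exact identity. For any `h`, applying `J_X* J_X + λ` to `h_X
- h` gives the sample average of the loss gradients `(f(x) - h(x)) k_x - λ h`
(`regGram_sampleRidge_sub`). At `h = h_λ` these gradients are centred by the normal equation for
`μ`, and bounded a.e. by `2 ‖(f - f_λ) κ‖_∞`: the first term has norm `|f - f_λ| κ`, and `λ h_λ` is
its mean.

Thus the error is at most `b` times the norm of an average of i.i.d. bounded centred vectors, where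
`b` bounds the inverse of `J_X* J_X + λ`. On the sampling event a perturbation argument gives `b =
‖(J* J + λ)⁻¹‖ / (1 - δ)`; for `λ > 0` positivity of `J_X* J_X` gives `b = 1 / λ`. The tail comes
from a dimension-free Hoeffding–Pinelis inequality, whose exponential moment is `cosh ‖S‖`: adding
one independent summand of norm at most `c` multiplies its mean by at most `cosh c`. -/

namespace KernelRidge

open ProbabilityTheory

/-! ### Hoeffding–Pinelis inequality in a Hilbert space -/

/-- The function `s ↦ cosh √s` is convex on `[0, ∞)`. -/
theorem cosh_le_of_sq_eq {p q u v w : ℝ} (hp : 0 ≤ p) (hq : 0 ≤ q) (hpq : p + q = 1)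
    (h : w ^ 2 = p * u ^ 2 + q * v ^ 2) :
    Real.cosh w ≤ p * Real.cosh u + q * Real.cosh v := by
  -- The series of `cosh` contains only powers of the square, each convex, so the comparison is
  -- termwise.
  refine hasSum_le (fun n => ?_) (Real.hasSum_cosh w)
    (((Real.hasSum_cosh u).mul_left p).add ((Real.hasSum_cosh v).mul_left q))
  have := (convexOn_pow (𝕜 := ℝ) n).2 (sq_nonneg u) (sq_nonneg v) hp hq hpq
  simp only [smul_eq_mul] at this
  rw [pow_mul, pow_mul, pow_mul, h, mul_div_assoc', mul_div_assoc', ← add_div]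
  gcongr

variable {F : Type*} [NormedAddCommGroup F] [InnerProductSpace ℝ F]

/-- `‖x + y‖²` is at most an affine function of `⟪y, x⟫`, with extreme values `(‖x‖ ± c)²`. The
convex function `cosh √s` lies below its chord, whose midpoint value is `cosh ‖x‖ * cosh c`. The
slope `b` does not depend on `y`, so the linear term disappears on averaging. -/
theorem exists_cosh_norm_add_le (x : F) {c : ℝ} (hc : 0 ≤ c) :
    ∃ b : ℝ, ∀ y : F, ‖y‖ ≤ c →
      Real.cosh ‖x + y‖ ≤ Real.cosh ‖x‖ * Real.cosh c + b * ⟪y, x⟫_ℝ := by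
  rcases hc.eq_or_lt with rfl | hc
  · refine ⟨0, fun y hy => ?_⟩
    simp [norm_le_zero_iff.1 hy]
  rcases eq_or_ne x 0 with rfl | hx
  · refine ⟨0, fun y hy => ?_⟩
    simpa [abs_of_pos hc] using hy
  set a := ‖x‖ with ha
  have ha0 : 0 < a := norm_pos_iff.2 hx
  refine ⟨(Real.cosh (a + c) - Real.cosh (a - c)) / (2 * (a * c)), fun y hy => ?_⟩
  set w := ⟪y, x⟫_ℝ with hw
  have hwa : |w| ≤ a * c := (abs_real_inner_le_norm y x).trans (by
    rw [mul_comm]; gcongr)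
  obtain ⟨hw1, hw2⟩ := abs_le.1 hwa
  have hac : 0 < a * c := mul_pos ha0 hc
  have h1 : ‖x + y‖ ≤ √(a ^ 2 + 2 * w + c ^ 2) := by
    refine Real.le_sqrt_of_sq_le ?_
    rw [norm_add_sq_real, real_inner_comm]
    gcongr
  have h2 : Real.cosh ‖x + y‖ ≤ Real.cosh (√(a ^ 2 + 2 * w + c ^ 2)) := by
    rw [Real.cosh_le_cosh, abs_of_nonneg (norm_nonneg _), abs_of_nonneg (Real.sqrt_nonneg _)]
    exact h1
  refine h2.trans ?_
  -- The weights solve `p + q = 1`, `p - q = w / (a * c)`, so that `p (a + c)² + q (a - c)² = a² + 2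
  -- w + c²`.
  have h3 := cosh_le_of_sq_eq (p := 1 / 2 + w / (2 * (a * c))) (q := 1 / 2 - w / (2 * (a * c)))
    (u := a + c) (v := a - c) (w := √(a ^ 2 + 2 * w + c ^ 2)) ?_ ?_ (by ring) ?_
  · refine h3.trans (le_of_eq ?_)
    have : Real.cosh a * Real.cosh c = (Real.cosh (a + c) + Real.cosh (a - c)) / 2 := by
      rw [Real.cosh_add, Real.cosh_sub]; ring
    rw [this]; ring
  · have : -(1 / 2) ≤ w / (2 * (a * c)) := by
      rw [le_div_iff₀ (by positivity)]; linarith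
    linarith
  · have : w / (2 * (a * c)) ≤ 1 / 2 := by
      rw [div_le_iff₀ (by positivity)]; linarith
    linarith
  · rw [Real.sq_sqrt (by nlinarith [sq_nonneg (a - c)])]
    field_simp
    ring

variable [MeasurableSpace F] [BorelSpace F] [SecondCountableTopology F]
  {Ω : Type*} [MeasurableSpace Ω]

/-- Centring is needed only weakly, against the fixed vector `x`, so no vector-valued integral
enters. -/
theorem lintegral_cosh_norm_add_le (μ : Measure Ω) [IsProbabilityMeasure μ] {Y : Ω → F}
    (hY : Measurable Y) {c : ℝ} (hc : 0 ≤ c) (hYc : ∀ᵐ ω ∂μ, ‖Y ω‖ ≤ c)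
    (hY0 : ∀ h : F, ∫ ω, ⟪Y ω, h⟫_ℝ ∂μ = 0) (x : F) :
    ∫⁻ ω, ENNReal.ofReal (Real.cosh ‖x + Y ω‖) ∂μ ≤
      ENNReal.ofReal (Real.cosh c) * ENNReal.ofReal (Real.cosh ‖x‖) := by
  obtain ⟨b, hb⟩ := exists_cosh_norm_add_le x hc
  have hint : Integrable (fun ω => ⟪Y ω, x⟫_ℝ) μ := by
    refine Integrable.of_bound (C := c * ‖x‖) (by fun_prop) ?_
    filter_upwards [hYc] with ω hω
    exact (norm_inner_le_norm _ _).trans (by gcongr)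
  have hint' : Integrable (fun ω => Real.cosh ‖x‖ * Real.cosh c + b * ⟪Y ω, x⟫_ℝ) μ :=
    (integrable_const _).add (hint.const_mul b)
  have hle : ∀ᵐ ω ∂μ, Real.cosh ‖x + Y ω‖ ≤ Real.cosh ‖x‖ * Real.cosh c + b * ⟪Y ω, x⟫_ℝ := by
    filter_upwards [hYc] with ω hω using hb _ hω
  calc ∫⁻ ω, ENNReal.ofReal (Real.cosh ‖x + Y ω‖) ∂μ
      ≤ ∫⁻ ω, ENNReal.ofReal (Real.cosh ‖x‖ * Real.cosh c + b * ⟪Y ω, x⟫_ℝ) ∂μ :=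
        lintegral_mono_ae (hle.mono fun ω hω => ENNReal.ofReal_le_ofReal hω)
    _ = ENNReal.ofReal (∫ ω, Real.cosh ‖x‖ * Real.cosh c + b * ⟪Y ω, x⟫_ℝ ∂μ) :=
        (ofReal_integral_eq_lintegral_ofReal hint'
          (hle.mono fun ω hω => (Real.cosh_pos _).le.trans hω)).symm
    _ = ENNReal.ofReal (Real.cosh c) * ENNReal.ofReal (Real.cosh ‖x‖) := by
        rw [integral_add (integrable_const _) (hint.const_mul b), integral_const_mul b, hY0]
        simp [mul_comm, ENNReal.ofReal_mul (Real.cosh_pos c).le]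

/-- The last summand is independent of the partial sum; by Tonelli it can be integrated first with
the partial sum frozen, at the cost of one factor `cosh c`. -/
theorem lintegral_cosh_norm_sum_le (μ : Measure Ω) [IsProbabilityMeasure μ] {Y : Ω → F}
    (hY : Measurable Y) {c : ℝ} (hc : 0 ≤ c) (hYc : ∀ᵐ ω ∂μ, ‖Y ω‖ ≤ c)
    (hY0 : ∀ h : F, ∫ ω, ⟪Y ω, h⟫_ℝ ∂μ = 0) (n : ℕ) :
    ∫⁻ X : ℕ → Ω, ENNReal.ofReal (Real.cosh ‖∑ i ∈ Finset.range n, Y (X i)‖)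
        ∂(Measure.infinitePi fun _ : ℕ => μ) ≤ ENNReal.ofReal (Real.cosh c) ^ n := by
  induction n with
  | zero => simp
  | succ n ih =>
    have hind := (iIndepFun_infinitePi (P := fun _ : ℕ => μ) (X := fun _ => Y)
      (fun _ => hY)).indepFun_sum_range_succ (fun i => hY.comp (measurable_pi_apply i)) n
    set P := Measure.infinitePi fun _ : ℕ => μ with hP
    have hS : Measurable (∑ j ∈ Finset.range n, fun X : ℕ → Ω => Y (X j)) := by
      convert Finset.measurable_sum (Finset.range n) fun i _ =>
        hY.comp (measurable_pi_apply (X := fun _ : ℕ => Ω) i) using 1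
      ext X
      simp
    have hYn : Measurable fun X : ℕ → Ω => Y (X n) := hY.comp (measurable_pi_apply n)
    have hprod := hind.map_prod_eq_prod_map_map hS.aemeasurable hYn.aemeasurable
    have hmap : P.map (fun X : ℕ → Ω => Y (X n)) = μ.map Y := by
      rw [show (fun X : ℕ → Ω => Y (X n)) = Y ∘ fun X => X n from rfl,
        ← Measure.map_map hY (measurable_pi_apply n),
        Measure.infinitePi_map_eval]
    rw [hmap] at hprod
    have hmeas : Measurable fun p : F × F => ENNReal.ofReal (Real.cosh ‖p.1 + p.2‖) := by
      fun_prop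
    have : IsProbabilityMeasure (μ.map Y) := Measure.isProbabilityMeasure_map hY.aemeasurable
    calc ∫⁻ X : ℕ → Ω, ENNReal.ofReal (Real.cosh ‖∑ i ∈ Finset.range (n + 1), Y (X i)‖) ∂P
        = ∫⁻ p : F × F, ENNReal.ofReal (Real.cosh ‖p.1 + p.2‖)
            ∂(P.map fun X => ((∑ j ∈ Finset.range n, fun X : ℕ → Ω => Y (X j)) X, Y (X n))) := by
          rw [lintegral_map hmeas (hS.prodMk hYn)]
          simp [Finset.sum_range_succ]
      _ = ∫⁻ x, ∫⁻ y, ENNReal.ofReal (Real.cosh ‖x + y‖) ∂(μ.map Y)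
            ∂(P.map (∑ j ∈ Finset.range n, fun X : ℕ → Ω => Y (X j))) := by
          rw [hprod, lintegral_prod _ hmeas.aemeasurable]
      _ ≤ ∫⁻ x, ENNReal.ofReal (Real.cosh c) * ENNReal.ofReal (Real.cosh ‖x‖)
            ∂(P.map (∑ j ∈ Finset.range n, fun X : ℕ → Ω => Y (X j))) := by
          refine lintegral_mono fun x => ?_
          rw [lintegral_map (by fun_prop) hY]
          exact lintegral_cosh_norm_add_le μ hY hc hYc hY0 x
      _ = ENNReal.ofReal (Real.cosh c) * ∫⁻ X : ℕ → Ω,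
            ENNReal.ofReal (Real.cosh ‖∑ i ∈ Finset.range n, Y (X i)‖) ∂P := by
          rw [lintegral_const_mul _ (by fun_prop), lintegral_map (by fun_prop) hS]
          simp
      _ ≤ ENNReal.ofReal (Real.cosh c) ^ (n + 1) := by
          rw [pow_succ']
          gcongr

/-- The Hoeffding--Pinelis inequality for sums of bounded, centred, independent and identically
distributed random variables with values in a separable Hilbert space. -/
theorem measureReal_le_norm_sum_le (μ : Measure Ω) [IsProbabilityMeasure μ] {Y : Ω → F}
    (hY : Measurable Y) {c : ℝ} (hc : 0 < c) (hYc : ∀ᵐ ω ∂μ, ‖Y ω‖ ≤ c)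
    (hY0 : ∀ h : F, ∫ ω, ⟪Y ω, h⟫_ℝ ∂μ = 0) {n : ℕ} (hn : 0 < n) {r : ℝ} (hr : 0 < r) :
    (Measure.infinitePi fun _ : ℕ => μ).real
        {X : ℕ → Ω | r ≤ ‖∑ i ∈ Finset.range n, Y (X i)‖} ≤
      2 * Real.exp (-r ^ 2 / (2 * (n * c ^ 2))) := by
  set P := Measure.infinitePi fun _ : ℕ => μ with hP
  have hn' : (0 : ℝ) < n := Nat.cast_pos.2 hn
  -- This `t` minimises the Chernoff exponent `n t² c² / 2 - t r`.
  set t : ℝ := r / (n * c ^ 2) with ht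
  have ht0 : 0 < t := by positivity
  have hmain := lintegral_cosh_norm_sum_le μ (Y := fun ω => t • Y ω) (by fun_prop)
    (c := t * c) (by positivity)
    (by
      filter_upwards [hYc] with ω hω
      rw [norm_smul, Real.norm_of_nonneg ht0.le]
      gcongr)
    (fun h => by simp [inner_smul_left, integral_const_mul, hY0]) n
  have hmarkov := mul_meas_ge_le_lintegral₀ (μ := P)
    (f := fun X : ℕ → Ω => ENNReal.ofReal (Real.cosh ‖∑ i ∈ Finset.range n, t • Y (X i)‖))
    (Real.continuous_cosh.measurable.comp (Finset.measurable_sum _ fun i _ =>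
      (hY.comp (measurable_pi_apply i)).const_smul t).norm).ennreal_ofReal.aemeasurable
    (ENNReal.ofReal (Real.cosh (t * r)))
  have hsub : {X : ℕ → Ω | r ≤ ‖∑ i ∈ Finset.range n, Y (X i)‖} ⊆
      {X | ENNReal.ofReal (Real.cosh (t * r)) ≤
        ENNReal.ofReal (Real.cosh ‖∑ i ∈ Finset.range n, t • Y (X i)‖)} := by
    intro X hX
    refine ENNReal.ofReal_le_ofReal ?_
    rw [Real.cosh_le_cosh, ← Finset.smul_sum, norm_smul, Real.norm_of_nonneg ht0.le,
      abs_of_nonneg (by positivity), abs_of_nonneg (by positivity)]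
    exact mul_le_mul_of_nonneg_left hX ht0.le
  have h1 : ENNReal.ofReal (Real.cosh (t * r)) *
      P {X : ℕ → Ω | r ≤ ‖∑ i ∈ Finset.range n, Y (X i)‖} ≤
      ENNReal.ofReal (Real.cosh (t * c)) ^ n :=
    (mul_le_mul_right (measure_mono hsub) _).trans (hmarkov.trans hmain)
  have h2 : Real.cosh (t * r) * P.real {X : ℕ → Ω | r ≤ ‖∑ i ∈ Finset.range n, Y (X i)‖} ≤
      Real.cosh (t * c) ^ n := by
    have := ENNReal.toReal_mono (by simp) h1
    rwa [ENNReal.toReal_mul, ENNReal.toReal_pow, ENNReal.toReal_ofReal (Real.cosh_pos _).le,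
      ENNReal.toReal_ofReal (Real.cosh_pos _).le] at this
  have h3 : Real.cosh (t * c) ^ n ≤ Real.exp (r ^ 2 / (2 * (n * c ^ 2))) := by
    calc Real.cosh (t * c) ^ n ≤ Real.exp ((t * c) ^ 2 / 2) ^ n :=
          pow_le_pow_left₀ (Real.cosh_pos _).le (Real.cosh_le_exp_half_sq _) n
      _ = Real.exp (r ^ 2 / (2 * (n * c ^ 2))) := by
          rw [← Real.exp_nat_mul]
          congr 1
          rw [ht]
          field_simp
  -- Discarding the decaying half of `cosh` produces the prefactor `2` of the tail.
  have h4 : Real.exp (r ^ 2 / (n * c ^ 2)) / 2 ≤ Real.cosh (t * r) := by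
    rw [Real.cosh_eq, show t * r = r ^ 2 / (n * c ^ 2) by rw [ht]; ring]
    linarith [Real.exp_pos (-(r ^ 2 / (n * c ^ 2)))]
  have h5 : Real.exp (r ^ 2 / (n * c ^ 2)) / 2 *
      P.real {X : ℕ → Ω | r ≤ ‖∑ i ∈ Finset.range n, Y (X i)‖} ≤
      Real.exp (r ^ 2 / (2 * (n * c ^ 2))) :=
    (mul_le_mul_of_nonneg_right h4 measureReal_nonneg).trans (h2.trans h3)
  rw [← mul_le_mul_iff_right₀ (show 0 < Real.exp (r ^ 2 / (n * c ^ 2)) / 2 by positivity)]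
  refine h5.trans (le_of_eq ?_)
  rw [div_mul_eq_mul_div, mul_left_comm (Real.exp _) (2 : ℝ) (Real.exp _),
    mul_div_cancel_left₀ _ (two_ne_zero (α := ℝ)), ← Real.exp_add]
  congr 1
  field_simp
  ring

/-- The averaged form of the Hoeffding--Pinelis inequality, including the degenerate case. -/
theorem measureReal_le_norm_average_le (μ : Measure Ω) [IsProbabilityMeasure μ] {Y : Ω → F}
    (hY : Measurable Y) {c : ℝ} (hc : 0 ≤ c) (hYc : ∀ᵐ ω ∂μ, ‖Y ω‖ ≤ c)
    (hY0 : ∀ h : F, ∫ ω, ⟪Y ω, h⟫_ℝ ∂μ = 0) {n : ℕ} (hn : 0 < n) {b : ℝ} (hb : 0 ≤ b)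
    {τ : ℝ} (hτ : 0 < τ) :
    (Measure.infinitePi fun _ : ℕ => μ).real
        {X : ℕ → Ω | τ ≤ b * ‖(n : ℝ)⁻¹ • ∑ i ∈ Finset.range n, Y (X i)‖} ≤
      tailBound ((b * c) ^ 2) n τ := by
  have hn' : (0 : ℝ) < n := Nat.cast_pos.2 hn
  have hset : {X : ℕ → Ω | τ ≤ b * ‖(n : ℝ)⁻¹ • ∑ i ∈ Finset.range n, Y (X i)‖} =
      {X : ℕ → Ω | τ * n ≤ ‖∑ i ∈ Finset.range n, b • Y (X i)‖} := by
    ext X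
    rw [Set.mem_ofPred_eq, Set.mem_ofPred_eq, ← Finset.smul_sum, norm_smul, norm_smul,
      Real.norm_of_nonneg hb, norm_inv, Real.norm_of_nonneg hn'.le, mul_left_comm,
      ← div_eq_inv_mul, le_div_iff₀ hn']
  have hbd : ∀ᵐ ω ∂μ, ‖b • Y ω‖ ≤ b * c := by
    filter_upwards [hYc] with ω hω
    rw [norm_smul, Real.norm_of_nonneg hb]
    gcongr
  rw [hset, tailBound]
  split_ifs with h0
  -- Here `b • Y` vanishes almost surely at all sample points at once, which is incompatible with `0
  -- < τ`.
  · have hbc : b * c = 0 := by simpa using h0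
    rw [hbc] at hbd
    refine le_of_eq ?_
    rw [measureReal_eq_zero_iff, measure_eq_zero_iff_ae_notMem]
    have hall : ∀ᵐ X ∂(Measure.infinitePi fun _ : ℕ => μ), ∀ i, b • Y (X i) = 0 := by
      refine ae_all_iff.2 fun i => ?_
      have := (measurePreserving_eval_infinitePi (fun _ : ℕ => μ) i).quasiMeasurePreserving.ae hbd
      filter_upwards [this] with X hX using norm_le_zero_iff.1 hX
    filter_upwards [hall] with X hX' hX
    simp only [hX', Finset.sum_const_zero, norm_zero] at hX
    nlinarith
  · have hbc : 0 < b * c := lt_of_le_of_ne (by positivity) fun h => h0 (by simp [← h])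
    refine (measureReal_le_norm_sum_le μ (Y := fun ω => b • Y ω) (by fun_prop) hbc hbd
      (fun h => by simp [inner_smul_left, integral_const_mul, hY0]) hn
      (by positivity : 0 < τ * n)).trans (le_of_eq ?_)
    congr 2
    field_simp

/-! ### Hilbert–Schmidt and operator norms -/

/-- The Hilbert--Schmidt norm dominates the operator norm. -/
theorem norm_le_of_hsNorm_le {G : Type*} [NormedAddCommGroup G] [InnerProductSpace ℝ G]
    [CompleteSpace G] {T : G →L[ℝ] G} {c : ℝ} (hc : 0 ≤ c) (h : hsNorm T ≤ ENNReal.ofReal c) :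
    ‖T‖ ≤ c := by
  set b := (exists_hilbertBasis ℝ G).choose_spec.choose with hb
  have h1 : ∑' i, ‖T (b i)‖ₑ ^ 2 ≤ ENNReal.ofReal (c ^ 2) := by
    have := ENNReal.rpow_le_rpow h (z := 2) (by norm_num)
    rw [hsNorm, ← ENNReal.rpow_mul] at this
    norm_num at this
    rwa [ENNReal.ofReal_pow hc]
  have h2 (s : Finset _) : ∑ i ∈ s, ‖T (b i)‖ ^ 2 ≤ c ^ 2 := by
    have h3 := (ENNReal.sum_le_tsum s).trans h1
    rw [← ENNReal.ofReal_le_ofReal_iff (by positivity),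
      ENNReal.ofReal_sum_of_nonneg (fun i _ => by positivity)]
    refine le_trans (le_of_eq (Finset.sum_congr rfl fun i _ => ?_)) h3
    rw [ENNReal.ofReal_pow (norm_nonneg _), ofReal_norm]
  refine T.opNorm_le_bound hc fun x => ?_
  have h4 := ((b.hasSum_repr x).mapL T).norm
  refine le_of_tendsto h4 (.of_forall fun s => ?_)
  -- Cauchy–Schwarz on finite partial sums, with Bessel's inequality for the coefficients.
  calc ‖∑ i ∈ s, T (b.repr x i • b i)‖ ≤ ∑ i ∈ s, ‖⟪b i, x⟫_ℝ‖ * ‖T (b i)‖ := by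
        refine (norm_sum_le _ _).trans (le_of_eq (Finset.sum_congr rfl fun i _ => ?_))
        rw [map_smul, norm_smul, b.repr_apply_apply]
    _ ≤ √(∑ i ∈ s, ‖⟪b i, x⟫_ℝ‖ ^ 2) * √(∑ i ∈ s, ‖T (b i)‖ ^ 2) :=
        Real.sum_mul_le_sqrt_mul_sqrt _ _ _
    _ ≤ ‖x‖ * c := by
        gcongr
        · exact Real.sqrt_le_iff.2 ⟨norm_nonneg _, b.orthonormal.sum_inner_products_le x⟩
        · exact Real.sqrt_le_iff.2 ⟨hc, h2 s⟩
    _ = c * ‖x‖ := mul_comm _ _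

end KernelRidge

/-! ### Loss gradients and the normal equations -/

namespace KernelRidge

theorem integral_empirical {E : Type*} [MeasurableSpace E] {g : E → ℝ} (hg : Measurable g)
    (n : ℕ) (X : ℕ → E) :
    ∫ x, g x ∂(empirical n X) = (n : ℝ)⁻¹ * ∑ i ∈ Finset.range n, g (X i) := by
  rw [empirical, integral_smul_measure, integral_finsetSum_measure]
  -- Singletons of `E` need not be measurable; measurability of `g` takes their place.
  · simp [integral_dirac' _ _ hg.stronglyMeasurable]
  · intro i _
    exact (integrable_const (g (X i))).congr
      ((ae_dirac_iff (measurableSet_eq_fun hg measurable_const)).2 rfl |>.mono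
        fun x hx => hx.symm)

variable {E : Type*} {H : Type*} [NormedAddCommGroup H] [InnerProductSpace ℝ H]
  [CompleteSpace H] [RKHS ℝ H E ℝ]

/-- The gradient `(f(x) - h(x)) k_x - λ h` at `h` of the regularized squared loss in `x`,
up to the factor `-2`. -/
noncomputable def lossGrad (f : E → ℝ) (lam : ℝ) (h : H) (x : E) : H :=
  (f x - h x) • RKHS.kerFun H x (1 : ℝ) - lam • h


theorem inner_lossGrad (f : E → ℝ) (lam : ℝ) (h v : H) (x : E) :
    ⟪lossGrad f lam h x, v⟫_ℝ = (f x - h x) * v x - lam * ⟪h, v⟫_ℝ := by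
  rw [lossGrad, inner_sub_left, inner_smul_left, inner_smul_left, real_inner_comm,
    inner_kerFun_one]
  simp

variable [MeasurableSpace E]

/-- By the reproducing property, the distance from `k_x` to a fixed `h` is `√(κ(x)² - 2 h(x) +
‖h‖²)`, measurable in `x`. Separability makes every open set a countable union of balls. -/
theorem measurable_kerFun_one [TopologicalSpace.SeparableSpace H] [MeasurableSpace H]
    [BorelSpace H] (hk : Measurable fun p : E × E => kernel H p.1 p.2) :
    Measurable fun x : E => RKHS.kerFun H x (1 : ℝ) := by
  have : SecondCountableTopology H := UniformSpace.secondCountable_of_separable H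
  have hnorm (h : H) : Measurable fun x : E => ‖RKHS.kerFun H x (1 : ℝ) - h‖ := by
    have heq : (fun x : E => ‖RKHS.kerFun H x (1 : ℝ) - h‖) =
        fun x => √(kappa H x ^ 2 - 2 * h x + ‖h‖ ^ 2) := by
      funext x
      rw [kappa_eq_norm, ← inner_kerFun_one h x, real_inner_comm, ← norm_sub_sq_real,
        Real.sqrt_sq (norm_nonneg _)]
    rw [heq]
    exact ((((measurable_kappa hk).pow_const 2).sub
      ((measurable_coe hk h).const_mul 2)).add_const _).sqrt
  refine measurable_of_isOpen fun U hU => ?_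
  choose! r hr0 hr using fun y (hy : y ∈ U) => Metric.isOpen_iff.1 hU y hy
  obtain ⟨T, hT, hTU⟩ := TopologicalSpace.isOpen_iUnion_countable
    (fun y : U => Metric.ball (y : H) (r y)) fun _ => Metric.isOpen_ball
  have hU' : U = ⋃ y ∈ T, Metric.ball (y : H) (r y) := by
    rw [hTU]
    refine Set.Subset.antisymm (fun y hy => ?_) (Set.iUnion_subset fun y => hr y y.2)
    exact Set.mem_iUnion.2 ⟨⟨y, hy⟩, Metric.mem_ball_self (hr0 y hy)⟩
  rw [hU', Set.preimage_iUnion₂]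
  refine MeasurableSet.biUnion hT fun y _ => ?_
  have : (fun x : E => RKHS.kerFun H x (1 : ℝ)) ⁻¹' Metric.ball (y : H) (r y) =
      {x | ‖RKHS.kerFun H x (1 : ℝ) - y‖ < r y} := by
    ext x
    rw [Set.mem_preimage, mem_ball_iff_norm, Set.mem_ofPred_eq]
  rw [this]
  exact measurableSet_lt (hnorm y) measurable_const

variable (hk : Measurable fun p : E × E => kernel H p.1 p.2) {ν : Measure E}
  (hκ : MemLp (kappa H) 2 ν) {f : E → ℝ}

theorem inner_adjoint_embedding (hf : MemLp f 2 ν) (h : H) :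
    ⟪(embedding hk ν hκ).adjoint (hf.toLp f), h⟫_ℝ = ∫ x, f x * h x ∂ν := by
  rw [ContinuousLinearMap.adjoint_inner_left, L2.inner_def]
  refine integral_congr_ae ?_
  filter_upwards [hf.coeFn_toLp, coeFn_embedding hk ν hκ h] with x h1 h2
  rw [h1, h2, real_inner_eq_re_inner, RCLike.inner_apply]
  simp [mul_comm]

theorem inner_gram (h v : H) : ⟪gram hk ν hκ h, v⟫_ℝ = ∫ x, h x * v x ∂ν :=
  inner_adjoint_embedding hk hκ (memLp_coe hk hκ h) v

theorem inner_regGram (lam : ℝ) (h v : H) :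
    ⟪regGram hk ν hκ lam h, v⟫_ℝ = ∫ x, h x * v x ∂ν + lam * ⟪h, v⟫_ℝ := by
  simp [regGram, inner_add_left, inner_smul_left, inner_gram]

theorem regGram_ridge (hf : MemLp f 2 ν) {lam : ℝ} (hinv : IsUnit (regGram hk ν hκ lam)) :
    regGram hk ν hκ lam (ridge hk ν hκ hf lam) =
      (embedding hk ν hκ).adjoint (hf.toLp f) := by
  rw [ridge, regInv, ← mul_apply_eq_comp, Ring.mul_inverse_cancel _ hinv,
    one_apply_eq_self]

/-- Weak normal equation for a general measure. It is used twice: for `μ` at its own solution,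
giving centred gradients, and for the empirical measure at `h_λ`, giving the error identity. -/
theorem inner_regGram_ridge_sub (hf : MemLp f 2 ν) {lam : ℝ}
    (hinv : IsUnit (regGram hk ν hκ lam)) (h v : H) :
    ⟪regGram hk ν hκ lam (ridge hk ν hκ hf lam - h), v⟫_ℝ =
      ∫ x, (f x - h x) * v x ∂ν - lam * ⟪h, v⟫_ℝ := by
  have h1 := hf.integrable_mul (memLp_coe hk hκ v)
  have h2 := (memLp_coe hk hκ h).integrable_mul (memLp_coe hk hκ v)
  have h3 := integral_sub h1 h2
  simp only [Pi.mul_apply] at h3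
  rw [map_sub, inner_sub_left, regGram_ridge hk hκ hf hinv, inner_adjoint_embedding,
    inner_regGram]
  simp_rw [sub_mul]
  rw [h3]
  ring

theorem norm_le_norm_regInv_mul {lam : ℝ} (hinv : IsUnit (regGram hk ν hκ lam)) (h : H) :
    ‖h‖ ≤ ‖regInv hk ν hκ lam‖ * ‖regGram hk ν hκ lam h‖ := by
  have : regInv hk ν hκ lam (regGram hk ν hκ lam h) = h := by
    rw [regInv, ← mul_apply_eq_comp, Ring.inverse_mul_cancel _ hinv,
      one_apply_eq_self]
  calc ‖h‖ = ‖regInv hk ν hκ lam (regGram hk ν hκ lam h)‖ := by rw [this]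
    _ ≤ _ := ContinuousLinearMap.le_opNorm _ _

theorem mul_norm_sq_le_inner_regGram (lam : ℝ) (h : H) :
    lam * ‖h‖ ^ 2 ≤ ⟪regGram hk ν hκ lam h, h⟫_ℝ := by
  rw [inner_regGram, real_inner_self_eq_norm_sq]
  exact le_add_of_nonneg_left (integral_nonneg fun x => mul_self_nonneg _)

/-- Since `J* J` is positive, the operator is coercive with constant `λ`. -/
theorem isUnit_regGram_of_pos {lam : ℝ} (hlam : 0 < lam) : IsUnit (regGram hk ν hκ lam) := by
  refine ContinuousLinearMap.isUnit_of_forall_le_norm_inner_map _ (c := lam.toNNReal)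
    (Real.toNNReal_pos.2 hlam) fun h => ?_
  rw [Real.coe_toNNReal _ hlam.le, mul_comm]
  exact (mul_norm_sq_le_inner_regGram hk hκ lam h).trans (le_abs_self _)

theorem mul_norm_le_norm_regGram (lam : ℝ) (h : H) :
    lam * ‖h‖ ≤ ‖regGram hk ν hκ lam h‖ := by
  rcases eq_or_ne h 0 with rfl | hh
  · simp
  have h1 := (mul_norm_sq_le_inner_regGram hk hκ lam h).trans (real_inner_le_norm _ _)
  rw [sq, ← mul_assoc] at h1
  exact le_of_mul_le_mul_right h1 (norm_pos_iff.2 hh)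

theorem norm_regInv_le_inv {lam : ℝ} (hlam : 0 < lam) : ‖regInv hk ν hκ lam‖ ≤ lam⁻¹ := by
  refine ContinuousLinearMap.opNorm_le_bound _ (by positivity) fun h => ?_
  have h1 := mul_norm_le_norm_regGram hk hκ lam (regInv hk ν hκ lam h)
  rw [regInv, ← mul_apply_eq_comp (regGram hk ν hκ lam),
    Ring.mul_inverse_cancel _ (isUnit_regGram_of_pos hk hκ hlam),
    one_apply_eq_self] at h1
  rw [← div_eq_inv_mul, le_div_iff₀ hlam, mul_comm]
  exact h1

theorem measurable_lossGrad [TopologicalSpace.SeparableSpace H] [MeasurableSpace H]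
    [BorelSpace H] (hk : Measurable fun p : E × E => kernel H p.1 p.2) (hfm : Measurable f)
    (lam : ℝ) (h : H) : Measurable (lossGrad f lam h : E → H) := by
  have : SecondCountableTopology H := UniformSpace.secondCountable_of_separable H
  exact ((hfm.sub (measurable_coe hk h)).smul (measurable_kerFun_one hk)).sub_const _

theorem regGram_sampleRidge_sub (hfm : Measurable f) {lam : ℝ} {n : ℕ} (hn : 0 < n)
    (X : ℕ → E) (hinv : IsUnit
      (regGram hk (empirical n X) (memLp_empirical (measurable_kappa hk) n X) lam)) (h : H) :
    regGram hk (empirical n X) (memLp_empirical (measurable_kappa hk) n X) lam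
        (sampleRidge hk hfm lam n X - h) =
      (n : ℝ)⁻¹ • ∑ i ∈ Finset.range n, lossGrad f lam h (X i) := by
  refine ext_inner_right ℝ fun v => ?_
  have hn' : (n : ℝ) ≠ 0 := Nat.cast_ne_zero.2 hn.ne'
  rw [sampleRidge, inner_regGram_ridge_sub _ _ _ hinv, integral_empirical
    (by exact (hfm.sub (measurable_coe hk h)).mul (measurable_coe hk v)), inner_smul_left, sum_inner]
  simp only [inner_lossGrad, Finset.sum_sub_distrib, Finset.sum_const, Finset.card_range,
    nsmul_eq_mul, conj_trivial]
  field_simp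

/-- First-order optimality of the regularized solution. Total mass one makes the constant `λ ⟪h, v⟫`
integrate to itself. -/
theorem integral_inner_lossGrad_ridge [IsProbabilityMeasure ν] (hf : MemLp f 2 ν) {lam : ℝ}
    (hinv : IsUnit (regGram hk ν hκ lam)) (v : H) :
    ∫ x, ⟪lossGrad f lam (ridge hk ν hκ hf lam) x, v⟫_ℝ ∂ν = 0 := by
  have h1 := inner_regGram_ridge_sub hk hκ hf hinv (ridge hk ν hκ hf lam) v
  rw [sub_self, map_zero, inner_zero_left] at h1
  simp_rw [inner_lossGrad]
  rw [integral_sub (by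
    exact (hf.sub (memLp_coe hk hκ _)).integrable_mul (memLp_coe hk hκ v))
    (integrable_const _)]
  simpa using h1.symm

/-! ### Sup-norm bounds for the residual and the gradient -/

/-- The reproducing bound `|h_λ| ≤ ‖h_λ‖ κ` gives `|(f - f_λ) κ| ≤ |f κ| + ‖h_λ‖ κ²` almost
everywhere. -/
theorem memLp_top_residualKappa {lam : ℝ} (hf : MemLp f 2 ν)
    (hκ_top : eLpNorm (kappa H : E → ℝ) ∞ ν < ∞)
    (hfκ_top : eLpNorm (fun x => f x * kappa H x) ∞ ν < ∞) :
    MemLp (residualKappa hk ν hκ hf lam) ∞ ν := by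
  have h1 := ae_le_eLpNormEssSup (μ := ν) (f := (kappa H : E → ℝ))
  have h2 := ae_le_eLpNormEssSup (μ := ν) (f := fun x : E => f x * kappa H x)
  rw [eLpNorm_exponent_top] at hκ_top hfκ_top
  refine memLp_top_of_bound ((hf.1.sub (Lp.aestronglyMeasurable _)).mul hκ.1)
    ((eLpNormEssSup (fun x => f x * kappa H x) ν).toReal + ‖ridge hk ν hκ hf lam‖ *
      (eLpNormEssSup (kappa H : E → ℝ) ν).toReal * (eLpNormEssSup (kappa H : E → ℝ) ν).toReal) ?_
  filter_upwards [h1, h2, coeFn_embedding hk ν hκ (ridge hk ν hκ hf lam)] with x h1 h2 h3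
  have h4 : ‖kappa H x‖ ≤ (eLpNormEssSup (kappa H : E → ℝ) ν).toReal := by
    rw [← toReal_enorm]
    exact ENNReal.toReal_mono hκ_top.ne h1
  have h5 : ‖f x * kappa H x‖ ≤ (eLpNormEssSup (fun x => f x * kappa H x) ν).toReal := by
    rw [← toReal_enorm]
    exact ENNReal.toReal_mono hfκ_top.ne h2
  rw [Real.norm_of_nonneg (kappa_nonneg x)] at h4
  rw [residualKappa, h3, sub_mul]
  refine (norm_sub_le _ _).trans (add_le_add h5 ?_)
  rw [norm_mul, Real.norm_of_nonneg (kappa_nonneg x)]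
  refine mul_le_mul ((abs_apply_le _ x).trans ?_) h4 (kappa_nonneg x) (by positivity)
  gcongr

theorem ae_norm_residualKappa_le {lam : ℝ} (hf : MemLp f 2 ν)
    (hr : MemLp (residualKappa hk ν hκ hf lam) ∞ ν) :
    ∀ᵐ x ∂ν, ‖(f x - ridge hk ν hκ hf lam x) • RKHS.kerFun H x (1 : ℝ)‖ ≤
      (eLpNorm (residualKappa hk ν hκ hf lam) ∞ ν).toReal := by
  have h1 := ae_le_eLpNormEssSup (μ := ν) (f := residualKappa hk ν hκ hf lam)
  filter_upwards [h1, coeFn_embedding hk ν hκ (ridge hk ν hκ hf lam)] with x h1 h3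
  have h4 := ENNReal.toReal_mono hr.2.ne ((eLpNorm_exponent_top (μ := ν)
    (f := residualKappa hk ν hκ hf lam)).symm ▸ h1)
  rwa [toReal_enorm, residualKappa, h3, norm_mul, kappa_eq_norm, norm_norm, ← norm_smul] at h4

/-- By the normal equation `λ h_λ` is the weak mean of `(f - h_λ) k_x`, whose norm is a.e. at most
the right-hand side. Testing against `λ h_λ` itself and cancelling one factor gives the bound. -/
theorem norm_smul_ridge_le [IsProbabilityMeasure ν] {lam : ℝ} (hf : MemLp f 2 ν)
    (hinv : IsUnit (regGram hk ν hκ lam))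
    (hr : MemLp (residualKappa hk ν hκ hf lam) ∞ ν) :
    ‖lam • ridge hk ν hκ hf lam‖ ≤ (eLpNorm (residualKappa hk ν hκ hf lam) ∞ ν).toReal := by
  set a := ridge hk ν hκ hf lam
  set M := (eLpNorm (residualKappa hk ν hκ hf lam) ∞ ν).toReal
  have h1 := inner_regGram_ridge_sub hk hκ hf hinv a (lam • a)
  rw [sub_self, map_zero, inner_zero_left, eq_comm, sub_eq_zero, ← real_inner_smul_left,
    real_inner_self_eq_norm_sq] at h1
  have h2 : ‖∫ x, (f x - a x) * (lam • a) x ∂ν‖ ≤ M * ‖lam • a‖ := by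
    refine (norm_integral_le_of_norm_le_const (C := M * ‖lam • a‖) ?_).trans (by simp)
    filter_upwards [ae_norm_residualKappa_le hk hκ hf hr] with x hx
    rw [← inner_kerFun_one (lam • a) x, ← real_inner_smul_right, mul_comm]
    refine (norm_inner_le_norm _ _).trans ?_
    gcongr
  rw [h1, norm_pow, norm_norm, sq] at h2
  rcases (norm_nonneg (lam • a)).eq_or_lt with h0 | h0
  · rw [← h0]; exact ENNReal.toReal_nonneg
  · exact le_of_mul_le_mul_right h2 h0

theorem ae_norm_lossGrad_ridge_le [IsProbabilityMeasure ν] {lam : ℝ} (hf : MemLp f 2 ν)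
    (hinv : IsUnit (regGram hk ν hκ lam))
    (hr : MemLp (residualKappa hk ν hκ hf lam) ∞ ν) :
    ∀ᵐ x ∂ν, ‖lossGrad f lam (ridge hk ν hκ hf lam) x‖ ≤
      2 * (eLpNorm (residualKappa hk ν hκ hf lam) ∞ ν).toReal := by
  filter_upwards [ae_norm_residualKappa_le hk hκ hf hr] with x hx
  rw [two_mul]
  exact (norm_sub_le _ _).trans (add_le_add hx (norm_smul_ridge_le hk hκ hf hinv hr))

/-! ### Stability of the regularized inverse -/

/-- On the sampling event, the sample operator is invertible and bounded from below. -/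
theorem isUnit_regGram_of_norm_sub_le [Nontrivial H] {ν' : Measure E}
    (hκ' : MemLp (kappa H) 2 ν') {lam δ : ℝ} (hδ1 : δ < 1)
    (hinv : IsUnit (regGram hk ν hκ lam))
    (h : ‖gram hk ν' hκ' - gram hk ν hκ‖ ≤ δ / ‖regInv hk ν hκ lam‖) :
    IsUnit (regGram hk ν' hκ' lam) ∧
      ∀ v : H, ‖v‖ ≤ ‖regInv hk ν hκ lam‖ / (1 - δ) * ‖regGram hk ν' hκ' lam v‖ := by
  -- Positivity, which needs `H` nontrivial, excludes the default value of division by zero in `δ /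
  -- ‖regInv hk ν hκ lam‖`.
  have hR : 0 < ‖regInv hk ν hκ lam‖ := by
    obtain ⟨v, hv⟩ := exists_ne (0 : H)
    refine lt_of_le_of_ne (norm_nonneg _) fun h0 => ?_
    have := norm_le_norm_regInv_mul hk hκ hinv v
    rw [← h0, zero_mul] at this
    exact hv (norm_le_zero_iff.1 this)
  have hsub : regGram hk ν' hκ' lam - regGram hk ν hκ lam =
      gram hk ν' hκ' - gram hk ν hκ := by
    rw [regGram, regGram, add_sub_add_right_eq_sub]
  constructor
  · have hu : regInv hk ν hκ lam = ↑(hinv.unit⁻¹) := by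
      rw [regInv, ← Ring.inverse_unit, IsUnit.unit_spec]
    -- Neumann series: the perturbation is smaller than the reciprocal norm of the inverse, strictly
    -- since `δ < 1`.
    refine (hinv.unit.ofNearby (regGram hk ν' hκ' lam) ?_).isUnit
    rw [IsUnit.unit_spec, hsub, ← hu]
    refine h.trans_lt ?_
    rw [div_eq_mul_inv]
    exact mul_lt_of_lt_one_left (inv_pos.2 hR) hδ1
  · intro v
    have h1 := norm_le_norm_regInv_mul hk hκ hinv v
    have h2 : ‖regGram hk ν hκ lam v‖ ≤ ‖regGram hk ν' hκ' lam v‖ +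
        δ / ‖regInv hk ν hκ lam‖ * ‖v‖ := by
      have : regGram hk ν hκ lam v = regGram hk ν' hκ' lam v -
          (gram hk ν' hκ' - gram hk ν hκ) v := by
        rw [← hsub, sub_apply, sub_sub_cancel]
      rw [this]
      refine (norm_sub_le _ _).trans ?_
      gcongr
      exact ContinuousLinearMap.le_of_opNorm_le _ h v
    have h3 : ‖v‖ ≤ ‖regInv hk ν hκ lam‖ * ‖regGram hk ν' hκ' lam v‖ + δ * ‖v‖ := by
      refine h1.trans ((mul_le_mul_of_nonneg_left h2 hR.le).trans (le_of_eq ?_))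
      field_simp
    rw [div_mul_eq_mul_div, le_div_iff₀ (sub_pos.2 hδ1)]
    linarith

/-! ### Norm of the asymptotic covariance -/

theorem norm_residualMul_le [IsProbabilityMeasure ν] {lam : ℝ} (hf : MemLp f 2 ν)
    (hr : MemLp (residualKappa hk ν hκ hf lam) ∞ ν) :
    ‖residualMul hk ν hκ hf lam (hr.mono_exponent le_top)‖ ≤
      (eLpNorm (residualKappa hk ν hκ hf lam) ∞ ν).toReal := by
  refine (LinearMap.mkContinuous_norm_le _ (norm_nonneg _) _).trans ?_
  rw [Lp.norm_toLp]
  exact ENNReal.toReal_mono hr.2.ne (eLpNorm_le_eLpNorm_of_exponent_le le_top hr.1)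

/-- Centring does not increase the norm of an operator `T* T`. -/
theorem norm_adjoint_comp_sub_smulRight_le {F G : Type*} [NormedAddCommGroup F]
    [InnerProductSpace ℝ F] [CompleteSpace F] [NormedAddCommGroup G] [InnerProductSpace ℝ G]
    [CompleteSpace G] (T : F →L[ℝ] G) {e : G} (he : ‖e‖ = 1) :
    ‖T.adjoint ∘L T - (innerSL ℝ (T.adjoint e)).smulRight (T.adjoint e)‖ ≤ ‖T‖ ^ 2 := by
  refine ContinuousLinearMap.opNorm_le_bound _ (by positivity) fun h => ?_
  -- Subtracting the rank-one term amounts to projecting `T h` orthogonally to the unit vector `e`.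
  have h1 : (T.adjoint ∘L T - (innerSL ℝ (T.adjoint e)).smulRight (T.adjoint e)) h =
      T.adjoint (T h - ⟪e, T h⟫_ℝ • e) := by
    simp [ContinuousLinearMap.adjoint_inner_left]
  have h2 : ‖T h - ⟪e, T h⟫_ℝ • e‖ ≤ ‖T h‖ := by
    rw [← sq_le_sq₀ (norm_nonneg _) (norm_nonneg _), norm_sub_sq_real, inner_smul_right,
      norm_smul, he, real_inner_comm, mul_one, Real.norm_eq_abs, sq_abs]
    nlinarith [sq_nonneg ⟪e, T h⟫_ℝ]
  rw [h1]
  calc ‖T.adjoint (T h - ⟪e, T h⟫_ℝ • e)‖ ≤ ‖T.adjoint‖ * ‖T h - ⟪e, T h⟫_ℝ • e‖ :=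
        ContinuousLinearMap.le_opNorm _ _
    _ ≤ ‖T‖ * (‖T‖ * ‖h‖) := by
        rw [LinearIsometryEquiv.norm_map]
        gcongr
        exact h2.trans (T.le_opNorm h)
    _ = ‖T‖ ^ 2 * ‖h‖ := by ring

theorem norm_asympCov_le [IsProbabilityMeasure ν] {lam : ℝ} (hf : MemLp f 2 ν)
    (hr : MemLp (residualKappa hk ν hκ hf lam) ∞ ν) :
    ‖asympCov hk ν hκ hf lam (hr.mono_exponent le_top)‖ ≤
      ((eLpNorm (residualKappa hk ν hκ hf lam) ∞ ν).toReal * ‖regInv hk ν hκ lam‖) ^ 2 := by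
  refine (norm_adjoint_comp_sub_smulRight_le _ ?_).trans ?_
  · rw [Lp.norm_toLp, eLpNorm_const _ (by simp) (IsProbabilityMeasure.ne_zero ν)]
    simp
  · gcongr
    refine (ContinuousLinearMap.opNorm_comp_le _ _).trans ?_
    gcongr
    exact norm_residualMul_le hk hκ hf hr

end KernelRidge

/-! ### The concentration inequality -/

open KernelRidge

theorem mainTheorem2
    {E : Type*} [MeasurableSpace E] (μ : Measure E) [IsProbabilityMeasure μ]
    {H : Type*} [NormedAddCommGroup H] [InnerProductSpace ℝ H] [CompleteSpace H]
    [TopologicalSpace.SeparableSpace H] [RKHS ℝ H E ℝ]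
    (hk : Measurable fun p : E × E => KernelRidge.kernel H p.1 p.2)
    (hκ : MemLp (KernelRidge.kappa H) 2 μ)
    (f : E → ℝ) (hfm : Measurable f) (hf : MemLp f 2 μ)
    (lam : ℝ) (hlam : 0 ≤ lam)
    (hinv : IsUnit (KernelRidge.regGram hk μ hκ lam))
    (δ : ℝ) (hδ0 : 0 ≤ δ) (hδ1 : δ < 1)
    (hκ_top : eLpNorm (KernelRidge.kappa H) ∞ μ < ∞)
    (hfκ_top : eLpNorm (fun x => f x * KernelRidge.kappa H x) ∞ μ < ∞) :
    ∃ hr : MemLp (KernelRidge.residualKappa hk μ hκ hf lam) ∞ μ,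
      (∀ n : ℕ, 0 < n → ∀ τ : ℝ, 0 < τ →
        (Measure.infinitePi fun _ : ℕ => μ).real
            {X | τ ≤ (KernelRidge.samplingEvent hk μ hκ lam δ n).indicator
              (fun X => ‖KernelRidge.sampleRidge hk hfm lam n X -
                KernelRidge.ridge hk μ hκ hf lam‖) X} ≤
          KernelRidge.tailBound (KernelRidge.constTruncated hk μ hκ hf lam δ) n τ) ∧
      (0 < lam →
        (∀ n : ℕ, 0 < n → ∀ τ : ℝ, 0 < τ →
          (Measure.infinitePi fun _ : ℕ => μ).real
              {X | τ ≤ ‖KernelRidge.sampleRidge hk hfm lam n X -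
                KernelRidge.ridge hk μ hκ hf lam‖} ≤
            KernelRidge.tailBound (KernelRidge.constFull hk μ hκ hf lam) n τ) ∧
        4 * ‖KernelRidge.asympCov hk μ hκ hf lam (hr.mono_exponent le_top)‖ ≤
          KernelRidge.constFull hk μ hκ hf lam) := by
  have hr : MemLp (residualKappa hk μ hκ hf lam) ∞ μ :=
    memLp_top_residualKappa hk hκ hf hκ_top hfκ_top
  borelize H
  have : SecondCountableTopology H := UniformSpace.secondCountable_of_separable H
  set M := (eLpNorm (residualKappa hk μ hκ hf lam) ∞ μ).toReal with hM
  have hM0 : 0 ≤ M := ENNReal.toReal_nonneg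
  set h := ridge hk μ hκ hf lam with hh
  have hδ : 0 < 1 - δ := sub_pos.2 hδ1
  -- Both tail bounds differ only in the inverse bound `b`; the `2` in `(2 * b) ^ 2` is the one from
  -- the gradient bound `2 * M`. The event `A` need not be measurable, as only monotonicity is used.
  have key {n : ℕ} (hn : 0 < n) {b : ℝ} (hb : 0 ≤ b) {τ : ℝ} (hτ : 0 < τ) {A : Set (ℕ → E)}
      (hA : A ⊆ {X | τ ≤ b * ‖(n : ℝ)⁻¹ • ∑ i ∈ Finset.range n, lossGrad f lam h (X i)‖}) :
      (Measure.infinitePi fun _ : ℕ => μ).real A ≤ tailBound ((2 * b) ^ 2 * M ^ 2) n τ := by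
    rw [show (2 * b) ^ 2 * M ^ 2 = (b * (2 * M)) ^ 2 by ring]
    exact (measureReal_mono hA).trans (measureReal_le_norm_average_le μ
      (measurable_lossGrad hk hfm lam h) (by positivity)
      (ae_norm_lossGrad_ridge_le hk hκ hf hinv hr)
      (integral_inner_lossGrad_ridge hk hκ hf hinv) hn hb hτ)
  refine ⟨hr, fun n hn τ hτ => ?_, fun hlam0 => ⟨fun n hn τ hτ => ?_, ?_⟩⟩
  · rw [constTruncated, mul_div_assoc]
    refine key hn (by positivity) hτ fun X hX => ?_
    have hX' : τ ≤ (samplingEvent hk μ hκ lam δ n).indicator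
        (fun X => ‖sampleRidge hk hfm lam n X - h‖) X := hX
    have hXS : X ∈ samplingEvent hk μ hκ lam δ n := by
      by_contra hXS
      rw [Set.indicator_of_notMem hXS] at hX'
      exact hτ.not_ge hX'
    rw [Set.indicator_of_mem hXS] at hX'
    -- An error of at least `τ > 0` already exhibits two distinct vectors.
    have : Nontrivial H := ⟨sampleRidge hk hfm lam n X, h, fun heq =>
      hτ.not_ge (hX'.trans (by rw [heq, sub_self, norm_zero]))⟩
    obtain ⟨hu, hlow⟩ := isUnit_regGram_of_norm_sub_le hk hκ
      (memLp_empirical (measurable_kappa hk) n X) hδ1 hinv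
      (norm_le_of_hsNorm_le (by positivity) hXS)
    have := hlow (sampleRidge hk hfm lam n X - h)
    rw [regGram_sampleRidge_sub hk hfm hn X hu] at this
    exact hX'.trans this
  · rw [constFull, div_eq_mul_inv]
    refine key hn (inv_nonneg.2 hlam) hτ fun X hX => ?_
    have hlow := mul_norm_le_norm_regGram hk (memLp_empirical (measurable_kappa hk) n X) lam
      (sampleRidge hk hfm lam n X - h)
    rw [regGram_sampleRidge_sub hk hfm hn X (isUnit_regGram_of_pos hk _ hlam0), mul_comm,
      ← le_div_iff₀ hlam0, div_eq_inv_mul] at hlow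
    exact le_trans hX hlow
  -- The chain is `‖Q‖ ≤ (M ‖(J* J + λ)⁻¹‖)² ≤ (M / λ)²`, and four times the last term is `C₂`.
  · have h1 := (norm_asympCov_le hk hκ hf hr).trans (pow_le_pow_left₀ (by positivity)
      (mul_le_mul_of_nonneg_left (norm_regInv_le_inv hk hκ hlam0) ENNReal.toReal_nonneg) 2)
    rw [constFull]
    refine (mul_le_mul_of_nonneg_left h1 (by norm_num)).trans (le_of_eq ?_)
    ring
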